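/- Let $q$ be an indeterminate. Write $(a;q)_0=1$, $(a;q)_k=\prod_{i=0}^{k-1}(1-aq^i)$ and $[m]=1+q+\cdots+q^{m-1}$. For $k\ge 0$ let \[ c_q(k)=\frac{(q^2;q^4)_k\,(-q;q^2)_k^2}{(q^4;q^4)_k\,(-q^4;q^4)_k^2}\,[6k+1]\,q^{k^2}, \qquad a_q(k)=\sum_{j=0}^{k}c_q(j)\,c_q(k-j). \] Then for every positive odd integer $n$, \[ \sum_{k=0}^{n-1}a_q(k)\equiv 0 \pmod{[n]}. \] Here, for a polynomial $P\in\mathbb{Z}[q]$ and a rational function $A$ in $q$ with integer coefficients, $A\equiv 0\pmod{P}$ means that $A=A_1/A_2$ with $A_1,A_2\in\mathbb{Z}[q]$, $A_2\neq 0$, such that $P$ divides $A_1$ and $\gcd(P,A_2)=1$ in $\mathbb{Z}[q]$. -/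

import Mathlib

open Polynomial

noncomputable section

/-- The `q`-shifted factorial `(a;q)_n = ∏_{i=0}^{n-1} (1 - a q^i)`. -/
def qShifted {R : Type*} [CommRing R] (a q : R) (n : ℕ) : R :=
  ∏ i ∈ Finset.range n, (1 - a * q ^ i)

/-- The `q`-integer `[n]_q = 1 + q + ⋯ + q^(n-1)`. -/
def qInt {R : Type*} [CommRing R] (q : R) (n : ℕ) : R :=
  ∑ i ∈ Finset.range n, q ^ i

/-- The congruence `A ≡ B (mod P)` between rational functions with integer coefficients, for
`P ∈ ℤ[q]`: the difference `A - B` is a fraction `A₁ / A₂` of integer polynomials such that `P`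
divides `A₁` and `gcd(P, A₂) = 1` in `ℤ[q]` (the only common divisors are units). If some fraction
for `A - B` is of this form, then so is the one in lowest terms. -/
def RatCongr (A B : RatFunc ℤ) (P : ℤ[X]) : Prop :=
  ∃ A₁ A₂ : ℤ[X], A₂ ≠ 0 ∧
    A - B = algebraMap ℤ[X] (RatFunc ℤ) A₁ / algebraMap ℤ[X] (RatFunc ℤ) A₂ ∧
    P ∣ A₁ ∧ IsRelPrime P A₂

/-- The term
`c_q(k) = (q²;q⁴)_k (-q;q²)_k² / ((q⁴;q⁴)_k (-q⁴;q⁴)_k²) · [6k+1]_q · q^(k²)`. -/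
def cTerm {K : Type*} [Field K] (q : K) (k : ℕ) : K :=
  qShifted (q ^ 2) (q ^ 4) k * qShifted (-q) (q ^ 2) k ^ 2 /
      (qShifted (q ^ 4) (q ^ 4) k * qShifted (-q ^ 4) (q ^ 4) k ^ 2) *
    qInt q (6 * k + 1) * q ^ (k ^ 2)

/-- The coefficient `a_q(k) = ∑_{j=0}^k c_q(j) c_q(k-j)` of the Cauchy square. -/
def aTerm {K : Type*} [Field K] (q : K) (k : ℕ) : K :=
  ∑ j ∈ Finset.range (k + 1), cTerm q j * cTerm q (k - j)

end

/-! Since `[n]` is the product of the cyclotomic polynomials `Φ_d` with `d ∣ n`, `d ≠ 1`, it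
suffices that the sum takes the value 0 at a primitive `d`-th root of unity `ζ` for each such `d =
2e+1` (`ratCongr_zero_of_hasValue`).

At `ζ` the terms factor over blocks of length `d`: `c(ud+v)` becomes `C u * c(v)`
(`hasValue_cTerm`). Moreover `c(v)` vanishes for `e < v < d`, and `c(0) + ⋯ + c(e) = 0`
(`sum_cTerm_eq_zero`): this sum is the specialisation of a terminating quadratic series with a
product formula (`quadSum_eq`, proved by a WZ recurrence), and the product contains the factor `1 -
ζ^d`.

In the Cauchy square, each `c(i)` multiplies a partial sum of the `c(j)`. Either `c(i)` vanishes at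
`ζ`, or the partial sum ends more than `e` places into a block and so vanishes
(`hasValue_sum_aTerm`). -/

/-- The ratio of consecutive terms (the factor `[6k+1]` left out) of the terminating quadratic
very-well-poised series which degenerates to `∑ c_q(k)` at roots of unity of order `2m+1`. -/
def quadRatio {K : Type*} [Field K] (q : K) (m k : ℕ) : K :=
  (q ^ (4 * m) - q ^ (4 * k)) * (1 - q ^ (2 * k + 1)) * (1 + q ^ (2 * k + 1)) ^ 2 *
      q ^ (2 * k + 3) /
    ((1 - q ^ (4 * m + 2 * k + 3)) * (1 - q ^ (4 * k + 4)) * (1 + q ^ (4 * k + 4)) ^ 2)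

/-- The term of the terminating quadratic series, without the factor `[6k+1]`. -/
def quadProd {K : Type*} [Field K] (q : K) (m k : ℕ) : K :=
  ∏ i ∈ Finset.range k, quadRatio q m i

/-- The terminating quadratic series. -/
def quadSum {K : Type*} [Field K] (q : K) (m : ℕ) : K :=
  ∑ k ∈ Finset.range (m + 1), quadProd q m k * qInt q (6 * k + 1)

/-! ### Product formula for the terminating quadratic series -/

section WZ

variable {K : Type*} [Field K] {q : K}

theorem quadProd_succ (m k : ℕ) : quadProd q m (k + 1) = quadProd q m k * quadRatio q m k := by
  rw [quadProd, Finset.prod_range_succ, quadProd]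

theorem quadProd_eq_zero {m k : ℕ} (h : m < k) : quadProd q m k = 0 :=
  Finset.prod_eq_zero (Finset.mem_range.2 h) (by simp [quadRatio])

theorem qInt_eq_div (hq : q ≠ 1) (n : ℕ) : qInt q n = (1 - q ^ n) / (1 - q) := by
  rw [qInt, geom_sum_eq hq, ← neg_sub, ← neg_sub 1 q, neg_div_neg_eq]

theorem one_sub_pow_ne_zero (hq : ∀ j : ℕ, 0 < j → q ^ j ≠ 1) {j : ℕ} (hj : 0 < j) :
    1 - q ^ j ≠ 0 :=
  sub_ne_zero.2 (hq j hj).symm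

theorem one_add_pow_ne_zero (hq : ∀ j : ℕ, 0 < j → q ^ j ≠ 1) {j : ℕ} (hj : 0 < j) :
    1 + q ^ j ≠ 0 := by
  intro h
  apply hq (j * 2) (by omega)
  rw [pow_mul]
  linear_combination (q ^ j - 1) * h

/-- Pairing index `k + 1` at `m + 1` with index `k` at `m` matches the factors `q^(4m+4) - q^(4i+4)`
and `q^(4m) - q^(4i)` one to one, so no factor that vanishes for `i = m` has to be divided out. -/
theorem quadProd_succ_succ (hq : ∀ j : ℕ, 0 < j → q ^ j ≠ 1) (m k : ℕ) :
    quadProd q (m + 1) (k + 1) = quadProd q m k *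
      ((q ^ (4 * m + 4) - 1) * q ^ (4 * k) * (1 - q ^ (2 * k + 1)) * (1 + q ^ (2 * k + 1)) ^ 2 *
        q ^ (2 * k + 3) * (1 - q ^ (4 * m + 3)) * (1 - q ^ (4 * m + 5)) /
      ((1 - q ^ (4 * k + 4)) * (1 + q ^ (4 * k + 4)) ^ 2 * (1 - q ^ (4 * m + 2 * k + 3)) *
        (1 - q ^ (4 * m + 2 * k + 5)) * (1 - q ^ (4 * m + 2 * k + 7)))) := by
  induction k with
  | zero =>
    have h1 := one_sub_pow_ne_zero hq (j := 4 * m + 3) (by omega)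
    have h2 := one_sub_pow_ne_zero hq (j := 4 * m + 5) (by omega)
    have h3 := one_sub_pow_ne_zero hq (j := 4 * m + 7) (by omega)
    have h4 := one_sub_pow_ne_zero hq (j := 4) (by omega)
    have h5 := one_add_pow_ne_zero hq (j := 4) (by omega)
    simp only [quadProd, Finset.prod_range_succ, Finset.prod_range_zero, quadRatio, mul_zero,
      zero_add, add_zero, one_mul, pow_zero, mul_one]
    rw [show 4 * (m + 1) + 3 = 4 * m + 7 by ring, show 4 * (m + 1) = 4 * m + 4 by ring]
    field_simp
  | succ k ih =>
    rw [quadProd_succ, ih, quadProd_succ]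
    generalize quadProd q m k = P
    simp only [quadRatio]
    rw [show 4 * (m + 1) + 2 * (k + 1) + 3 = 4 * m + 2 * k + 9 by ring,
      show 4 * m + 2 * (k + 1) + 7 = 4 * m + 2 * k + 9 by ring,
      show 4 * m + 2 * (k + 1) + 5 = 4 * m + 2 * k + 7 by ring,
      show 4 * m + 2 * (k + 1) + 3 = 4 * m + 2 * k + 5 by ring,
      show 4 * (k + 1) + 4 = 4 * k + 8 by ring, show 4 * (k + 1) = 4 * k + 4 by ring]
    rw [show 2 * (k + 1) + 1 = 2 * k + 3 by ring, show 2 * (k + 1) + 3 = 2 * k + 5 by ring]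
    generalize 1 - q ^ (4 * m + 2 * k + 3) = D1
    generalize 1 - q ^ (4 * m + 2 * k + 5) = D2
    generalize 1 - q ^ (4 * m + 2 * k + 7) = D3
    generalize 1 - q ^ (4 * k + 4) = D5
    generalize 1 + q ^ (4 * k + 4) = D6
    generalize 1 - q ^ (4 * m + 2 * k + 9) = D4
    generalize 1 - q ^ (4 * k + 8) = D7
    generalize 1 + q ^ (4 * k + 8) = D8
    rw [show q ^ (4 * (m + 1)) - q ^ (4 * k + 4) = q ^ 4 * (q ^ (4 * m) - q ^ (4 * k)) by ring,
      pow_add q (4 * k) 4]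
    ring

/-- A WZ pair in summed form: the right side is the certificate, a rational multiple of `quadProd q
m k`, so it vanishes once `k > m`. -/
theorem quadSum_partial (hq : ∀ j : ℕ, 0 < j → q ^ j ≠ 1) (m k : ℕ) :
    ∑ i ∈ Finset.range (k + 1), ((1 + q ^ (4 * m + 4)) ^ 2 * quadProd q (m + 1) i -
        (1 - q ^ (4 * m + 3)) * (1 - q ^ (4 * m + 5)) * quadProd q m i) * qInt q (6 * i + 1) =
      (1 - q ^ (4 * m + 3)) * (1 - q ^ (4 * m + 5)) * q ^ (4 * m + 2 * k + 3) *
        (1 - q ^ (2 * k + 1)) * (1 + q ^ (2 * k + 1)) ^ 2 * quadProd q m k /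
        ((1 - q) * (1 - q ^ (4 * m + 2 * k + 3)) * (1 - q ^ (4 * m + 2 * k + 5))) := by
  have hq1 : q ≠ 1 := by simpa using hq 1 one_pos
  have h0 : 1 - q ≠ 0 := sub_ne_zero.2 hq1.symm
  induction k with
  | zero =>
    have h1 := one_sub_pow_ne_zero hq (j := 4 * m + 3) (by omega)
    have h2 := one_sub_pow_ne_zero hq (j := 4 * m + 5) (by omega)
    simp only [quadProd, Finset.sum_range_succ, Finset.sum_range_zero, Finset.prod_range_zero,
      mul_zero, zero_add, add_zero, mul_one, qInt_eq_div hq1, pow_one]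
    field_simp
    ring
  | succ k ih =>
    have h1 := one_sub_pow_ne_zero hq (j := 4 * m + 2 * k + 3) (by omega)
    have h2 := one_sub_pow_ne_zero hq (j := 4 * m + 2 * k + 5) (by omega)
    have h3 := one_sub_pow_ne_zero hq (j := 4 * m + 2 * k + 7) (by omega)
    have h5 := one_sub_pow_ne_zero hq (j := 4 * k + 4) (by omega)
    have h6 := one_add_pow_ne_zero hq (j := 4 * k + 4) (by omega)
    rw [Finset.sum_range_succ, ih, quadProd_succ_succ hq, quadProd_succ, qInt_eq_div hq1,
      quadRatio]
    generalize quadProd q m k = P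
    rw [show 4 * m + 2 * (k + 1) + 5 = 4 * m + 2 * k + 7 by ring,
      show 4 * m + 2 * (k + 1) + 3 = 4 * m + 2 * k + 5 by ring]
    rw [show 2 * (k + 1) + 1 = 2 * k + 3 by ring]
    -- The denominators become atoms while fractions are cleared; the identity left over needs the
    -- values of only four of them.
    generalize d1 : 1 - q ^ (4 * m + 2 * k + 3) = D1 at *
    generalize d2 : 1 - q ^ (4 * m + 2 * k + 5) = D2 at *
    generalize d3 : 1 - q ^ (4 * m + 2 * k + 7) = D3 at *
    generalize d5 : 1 - q ^ (4 * k + 4) = D5 at *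
    generalize d6 : 1 + q ^ (4 * k + 4) = D6 at *
    generalize d0 : 1 - q = D0 at *
    field_simp
    simp only [← d2, ← d3, ← d5, ← d6]
    ring

theorem quadSum_succ (hq : ∀ j : ℕ, 0 < j → q ^ j ≠ 1) (m : ℕ) :
    quadSum q (m + 1) * (1 + q ^ (4 * m + 4)) ^ 2 =
      quadSum q m * ((1 - q ^ (4 * m + 3)) * (1 - q ^ (4 * m + 5))) := by
  have h := quadSum_partial hq m (m + 1)
  rw [quadProd_eq_zero (Nat.lt_succ_self m)] at h
  have h2 : quadSum q m = ∑ k ∈ Finset.range (m + 1 + 1),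
      quadProd q m k * qInt q (6 * k + 1) := by
    rw [Finset.sum_range_succ, quadProd_eq_zero (Nat.lt_succ_self m), zero_mul, add_zero, quadSum]
  rw [h2, quadSum, ← sub_eq_zero, Finset.sum_mul, Finset.sum_mul, ← Finset.sum_sub_distrib]
  simp only [mul_zero, zero_div] at h
  rw [← h]
  refine Finset.sum_congr rfl fun i _ => ?_
  ring

theorem quadSum_eq (hq : ∀ j : ℕ, 0 < j → q ^ j ≠ 1) (m : ℕ) :
    quadSum q m * ∏ i ∈ Finset.range m, (1 + q ^ (4 * i + 4)) ^ 2 =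
      ∏ i ∈ Finset.range m, ((1 - q ^ (4 * i + 3)) * (1 - q ^ (4 * i + 5))) := by
  induction m with
  | zero => simp [quadSum, quadProd, qInt]
  | succ m ih =>
    rw [Finset.prod_range_succ, Finset.prod_range_succ, ← ih]
    linear_combination (∏ i ∈ Finset.range m, (1 + q ^ (4 * i + 4)) ^ 2) * quadSum_succ hq m

end WZ

/-! ### Values of rational functions at a complex number -/

/-- The rational function `f` with integer coefficients is regular at `ζ` and takes the
value `z` there. -/
def HasValue (ζ : ℂ) (f : RatFunc ℤ) (z : ℂ) : Prop :=
  ∃ a b : ℤ[X], aeval ζ b ≠ 0 ∧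
    f * algebraMap ℤ[X] (RatFunc ℤ) b = algebraMap ℤ[X] (RatFunc ℤ) a ∧
    z * aeval ζ b = aeval ζ a

namespace HasValue

variable {ζ : ℂ} {f g : RatFunc ℤ} {z w : ℂ}

theorem unique (hf : HasValue ζ f z) (hf' : HasValue ζ f w) : z = w := by
  obtain ⟨a, b, hb, h1, h2⟩ := hf
  obtain ⟨a', b', hb', h1', h2'⟩ := hf'
  have h : a * b' = a' * b := by
    apply RatFunc.algebraMap_injective ℤ
    rw [map_mul, map_mul, ← h1, ← h1']
    ring
  have h3 := congrArg (aeval ζ) h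
  rw [map_mul, map_mul, ← h2, ← h2'] at h3
  apply mul_right_cancel₀ (mul_ne_zero hb hb')
  linear_combination h3

theorem algebraMap (p : ℤ[X]) : HasValue ζ (algebraMap ℤ[X] (RatFunc ℤ) p) (aeval ζ p) :=
  ⟨p, 1, by simp, by simp, by simp⟩

theorem X : HasValue ζ RatFunc.X ζ := by
  simpa using algebraMap (ζ := ζ) (Polynomial.X : ℤ[X])

theorem one : HasValue ζ 1 1 := by simpa using algebraMap (ζ := ζ) (1 : ℤ[X])

theorem zero : HasValue ζ 0 0 := by simpa using algebraMap (ζ := ζ) (0 : ℤ[X])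

theorem add (hf : HasValue ζ f z) (hg : HasValue ζ g w) : HasValue ζ (f + g) (z + w) := by
  obtain ⟨a, b, hb, h1, h2⟩ := hf
  obtain ⟨a', b', hb', h1', h2'⟩ := hg
  refine ⟨a * b' + a' * b, b * b', ?_, ?_, ?_⟩
  · rw [map_mul]; exact mul_ne_zero hb hb'
  · simp only [map_mul, map_add, ← h1, ← h1']; ring
  · simp only [map_mul, map_add, ← h2, ← h2']; ring

theorem neg (hf : HasValue ζ f z) : HasValue ζ (-f) (-z) := by
  obtain ⟨a, b, hb, h1, h2⟩ := hf
  exact ⟨-a, b, hb, by rw [map_neg, ← h1, neg_mul], by rw [map_neg, ← h2, neg_mul]⟩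

theorem sub (hf : HasValue ζ f z) (hg : HasValue ζ g w) : HasValue ζ (f - g) (z - w) := by
  simpa only [sub_eq_add_neg] using hf.add hg.neg

theorem mul (hf : HasValue ζ f z) (hg : HasValue ζ g w) : HasValue ζ (f * g) (z * w) := by
  obtain ⟨a, b, hb, h1, h2⟩ := hf
  obtain ⟨a', b', hb', h1', h2'⟩ := hg
  refine ⟨a * a', b * b', ?_, ?_, ?_⟩
  · rw [map_mul]; exact mul_ne_zero hb hb'
  · simp only [map_mul, ← h1, ← h1']; ring
  · simp only [map_mul, ← h2, ← h2']; ring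

theorem ne_zero (hf : HasValue ζ f z) (hz : z ≠ 0) : f ≠ 0 := by
  rintro rfl
  exact hz (hf.unique zero)

theorem inv (hf : HasValue ζ f z) (hz : z ≠ 0) : HasValue ζ f⁻¹ z⁻¹ := by
  have hf0 := hf.ne_zero hz
  obtain ⟨a, b, hb, h1, h2⟩ := hf
  refine ⟨b, a, h2 ▸ mul_ne_zero hz hb, ?_, ?_⟩
  · rw [← h1, inv_mul_cancel_left₀ hf0]
  · rw [← h2, inv_mul_cancel_left₀ hz]

theorem div (hf : HasValue ζ f z) (hg : HasValue ζ g w) (hw : w ≠ 0) :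
    HasValue ζ (f / g) (z / w) := by
  simpa only [div_eq_mul_inv] using hf.mul (hg.inv hw)

theorem pow (hf : HasValue ζ f z) (n : ℕ) : HasValue ζ (f ^ n) (z ^ n) := by
  induction n with
  | zero => simpa using one
  | succ n ih => simpa only [pow_succ] using ih.mul hf

theorem sum {ι : Type*} {s : Finset ι} {f : ι → RatFunc ℤ} {z : ι → ℂ}
    (h : ∀ i ∈ s, HasValue ζ (f i) (z i)) : HasValue ζ (∑ i ∈ s, f i) (∑ i ∈ s, z i) := by
  classical
  induction s using Finset.induction_on with
  | empty => simpa using zero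
  | insert i s hi ih =>
    rw [Finset.sum_insert hi, Finset.sum_insert hi]
    exact (h i (Finset.mem_insert_self i s)).add
      (ih fun j hj => h j (Finset.mem_insert_of_mem hj))

theorem prod {ι : Type*} {s : Finset ι} {f : ι → RatFunc ℤ} {z : ι → ℂ}
    (h : ∀ i ∈ s, HasValue ζ (f i) (z i)) : HasValue ζ (∏ i ∈ s, f i) (∏ i ∈ s, z i) := by
  classical
  induction s using Finset.induction_on with
  | empty => simpa using one
  | insert i s hi ih =>
    rw [Finset.prod_insert hi, Finset.prod_insert hi]
    exact (h i (Finset.mem_insert_self i s)).mul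
      (ih fun j hj => h j (Finset.mem_insert_of_mem hj))

theorem qShifted (hf : HasValue ζ f z) (hg : HasValue ζ g w) (n : ℕ) :
    HasValue ζ (qShifted f g n) (qShifted z w n) :=
  prod fun _ _ => one.sub (hf.mul (hg.pow _))

theorem qInt (hf : HasValue ζ f z) (n : ℕ) : HasValue ζ (qInt f n) (qInt z n) :=
  sum fun _ _ => hf.pow _

end HasValue

theorem qShifted_add {R : Type*} [CommRing R] (a q : R) (m n : ℕ) :
    qShifted a q (m + n) = qShifted a q m * qShifted (a * q ^ m) q n := by
  simp only [qShifted, Finset.prod_range_add, pow_add, mul_assoc]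

theorem RatFunc.X_pow_ne_one {j : ℕ} (hj : 0 < j) : (RatFunc.X : RatFunc ℤ) ^ j ≠ 1 := by
  intro h
  have h2 : (Polynomial.X : ℤ[X]) ^ j = 1 := by
    apply RatFunc.algebraMap_injective ℤ
    simpa using h
  have h3 := congrArg natDegree h2
  simp at h3
  omega

/-! ### The terms at a root of unity of odd order -/

section RootOfUnity

variable {ζ : ℂ} {e : ℕ}

theorem IsPrimitiveRoot.one_add_pow_ne_zero (h : IsPrimitiveRoot ζ (2 * e + 1)) (j : ℕ) :
    1 + ζ ^ j ≠ 0 := by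
  intro h0
  have h1 : ζ ^ j = -1 := by linear_combination h0
  have h2 : (ζ ^ j) ^ (2 * e + 1) = 1 := by
    rw [← pow_mul, mul_comm, pow_mul, h.pow_eq_one, one_pow]
  rw [h1, Odd.neg_one_pow ⟨e, rfl⟩] at h2
  norm_num at h2

theorem IsPrimitiveRoot.one_sub_pow_ne_zero {d : ℕ} (h : IsPrimitiveRoot ζ d) {j : ℕ}
    (hj : ¬ d ∣ j) : 1 - ζ ^ j ≠ 0 := by
  intro h0
  exact hj ((h.pow_eq_one_iff_dvd j).1 (by linear_combination -h0))

theorem IsPrimitiveRoot.one_sub_pow_four_ne_zero (h : IsPrimitiveRoot ζ (2 * e + 1)) {i : ℕ}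
    (hi : i < 2 * e) : 1 - ζ ^ (4 * (i + 1)) ≠ 0 := by
  refine h.one_sub_pow_ne_zero fun hd => ?_
  have hc : Nat.Coprime (2 * e + 1) 4 :=
    Nat.Coprime.pow_right 2 (Nat.coprime_two_right.2 ⟨e, rfl⟩)
  have := Nat.le_of_dvd (by omega) (hc.dvd_of_dvd_mul_left hd)
  omega

theorem qShifted_four_ne_zero (h : IsPrimitiveRoot ζ (2 * e + 1)) {k : ℕ} (hk : k ≤ 2 * e) :
    qShifted (ζ ^ 4) (ζ ^ 4) k ≠ 0 := by
  refine Finset.prod_ne_zero_iff.2 fun i hi => ?_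
  have := h.one_sub_pow_four_ne_zero (i := i) (by have := Finset.mem_range.1 hi; omega)
  rwa [← pow_mul, ← pow_add, show 4 + 4 * i = 4 * (i + 1) by ring]

theorem qShifted_neg_four_ne_zero (h : IsPrimitiveRoot ζ (2 * e + 1)) (k : ℕ) :
    qShifted (-ζ ^ 4) (ζ ^ 4) k ≠ 0 := by
  refine Finset.prod_ne_zero_iff.2 fun i _ => ?_
  have := h.one_add_pow_ne_zero (4 * (i + 1))
  rw [← pow_mul, neg_mul, sub_neg_eq_add, ← pow_add]
  rwa [show 4 + 4 * i = 4 * (i + 1) by ring]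

theorem cTerm_eq_zero (h : IsPrimitiveRoot ζ (2 * e + 1)) {k : ℕ} (hk : e < k) :
    cTerm ζ k = 0 := by
  have : qShifted (ζ ^ 2) (ζ ^ 4) k = 0 := by
    refine Finset.prod_eq_zero (Finset.mem_range.2 hk) ?_
    rw [← pow_mul, ← pow_add, show 2 + 4 * e = (2 * e + 1) * 2 by ring, pow_mul, h.pow_eq_one]
    simp
  simp [cTerm, this]

/-- With `m = e`, `ζ^(4m) = ζ^(-2)` turns `q^(4m) - q^(4k)` into a multiple of `1 - q^(4k+2)`, and
`1 - q^(4m+2k+3)` cancels `1 - q^(2k+1)`. The bound on `k` keeps the cancelled factors nonzero. -/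
theorem quadProd_mul_eq_cTerm (h : IsPrimitiveRoot ζ (2 * e + 1)) {k : ℕ} (hk : k ≤ e) :
    quadProd ζ e k * qInt ζ (6 * k + 1) = cTerm ζ k := by
  have hp : quadProd ζ e k = qShifted (ζ ^ 2) (ζ ^ 4) k * qShifted (-ζ) (ζ ^ 2) k ^ 2 /
      (qShifted (ζ ^ 4) (ζ ^ 4) k * qShifted (-ζ ^ 4) (ζ ^ 4) k ^ 2) * ζ ^ (k ^ 2) := by
    induction k with
    | zero => simp [quadProd, qShifted]
    | succ k ih =>
      have h1 := h.one_sub_pow_four_ne_zero (i := k) (by omega)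
      have h2 := h.one_add_pow_ne_zero (4 * (k + 1))
      have h3 := h.one_sub_pow_ne_zero (j := 2 * k + 1) fun hd => by
        have := Nat.le_of_dvd (by omega) hd
        omega
      have h6 : 1 - ζ ^ 4 * (ζ ^ 4) ^ k = 1 - ζ ^ (4 * (k + 1)) := by ring
      have h7 : 1 - -ζ ^ 4 * (ζ ^ 4) ^ k = 1 + ζ ^ (4 * (k + 1)) := by ring
      have h8 : 1 - ζ ^ (4 * e + 2 * k + 3) = 1 - ζ ^ (2 * k + 1) := by
        rw [show 4 * e + 2 * k + 3 = (2 * e + 1) * 2 + (2 * k + 1) by ring, pow_add, pow_mul,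
          h.pow_eq_one]
        ring
      have h9 : ζ ^ (4 * e) * ζ ^ 2 = 1 := by
        rw [← pow_add, show 4 * e + 2 = (2 * e + 1) * 2 by ring, pow_mul, h.pow_eq_one, one_pow]
      have h10 : quadRatio ζ e k = (1 - ζ ^ 2 * (ζ ^ 4) ^ k) * (1 - -ζ * (ζ ^ 2) ^ k) ^ 2 *
          ζ ^ (2 * k + 1) / ((1 - ζ ^ (4 * (k + 1))) * (1 + ζ ^ (4 * (k + 1))) ^ 2) := by
        rw [quadRatio, h8, show 4 * k + 4 = 4 * (k + 1) by ring,
          div_eq_div_iff (mul_ne_zero (mul_ne_zero h3 h1) (pow_ne_zero 2 h2))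
            (mul_ne_zero h1 (pow_ne_zero 2 h2))]
        linear_combination ((1 - ζ ^ (2 * k + 1)) * (1 + ζ ^ (2 * k + 1)) ^ 2 * ζ ^ (2 * k + 1) *
          ((1 - ζ ^ (4 * (k + 1))) * (1 + ζ ^ (4 * (k + 1))) ^ 2)) * h9
      rw [quadProd_succ, ih (by omega), h10]
      simp only [qShifted, Finset.prod_range_succ]
      rw [h6, h7, show (k + 1) ^ 2 = k ^ 2 + (2 * k + 1) by ring, pow_add ζ (k ^ 2)]
      generalize 1 - ζ ^ (4 * (k + 1)) = D
      generalize 1 + ζ ^ (4 * (k + 1)) = E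
      ring
  rw [hp, cTerm]
  ring

end RootOfUnity

/-! ### Vanishing sums and block structure at a root of unity -/

section RootOfUnity

variable {ζ : ℂ} {e : ℕ}

theorem hasValue_quadProd (h : IsPrimitiveRoot ζ (2 * e + 1)) {k : ℕ} (hk : k ≤ e) :
    HasValue ζ (quadProd RatFunc.X e k) (quadProd ζ e k) := by
  refine HasValue.prod fun i hi => ?_
  have hi' := Finset.mem_range.1 hi
  have hX (j : ℕ) : HasValue ζ (RatFunc.X ^ j) (ζ ^ j) := HasValue.X.pow j
  have hm (j : ℕ) : HasValue ζ (1 - RatFunc.X ^ j) (1 - ζ ^ j) := HasValue.one.sub (hX j)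
  have hp (j : ℕ) : HasValue ζ (1 + RatFunc.X ^ j) (1 + ζ ^ j) := HasValue.one.add (hX j)
  refine ((((hX _).sub (hX _)).mul (hm _)).mul ((hp _).pow 2)).mul (hX _) |>.div
    (((hm _).mul (hm _)).mul ((hp _).pow 2)) ?_
  refine mul_ne_zero (mul_ne_zero ?_ ?_) (pow_ne_zero 2 (h.one_add_pow_ne_zero _))
  · refine h.one_sub_pow_ne_zero fun hd => ?_
    rw [show 4 * e + 2 * i + 3 = (2 * e + 1) * 2 + (2 * i + 1) by ring,
      Nat.dvd_add_right (dvd_mul_right _ _)] at hd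
    have := Nat.le_of_dvd (by omega) hd
    omega
  · exact h.one_sub_pow_four_ne_zero (by omega)

/-- The product formula needs `q` not a root of unity, so it is applied to the indeterminate and
then specialised at `ζ`, where all terms involved are regular. -/
theorem sum_cTerm_eq_zero (h : IsPrimitiveRoot ζ (2 * e + 1)) (he : 0 < e) {r : ℕ} (hr : e < r) :
    ∑ k ∈ Finset.range r, cTerm ζ k = 0 := by
  have h1 : ∑ k ∈ Finset.range r, cTerm ζ k = quadSum ζ e := by
    rw [quadSum, ← Finset.sum_subset (Finset.range_mono (show e + 1 ≤ r from hr))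
      fun k _ hk => cTerm_eq_zero h (by simpa using hk)]
    exact Finset.sum_congr rfl fun k hk =>
      (quadProd_mul_eq_cTerm h (Nat.lt_succ_iff.1 (Finset.mem_range.1 hk))).symm
  have h2 : HasValue ζ (quadSum RatFunc.X e) (quadSum ζ e) := HasValue.sum fun k hk =>
    (hasValue_quadProd h (Nat.lt_succ_iff.1 (Finset.mem_range.1 hk))).mul (HasValue.X.qInt _)
  have hX (j : ℕ) : HasValue ζ (RatFunc.X ^ j) (ζ ^ j) := HasValue.X.pow j
  have h3 := h2.mul (HasValue.prod (s := Finset.range e) fun i _ =>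
    (HasValue.one.add (hX (4 * i + 4))).pow 2)
  rw [quadSum_eq fun j hj => RatFunc.X_pow_ne_one hj] at h3
  have h4 := h3.unique (HasValue.prod (s := Finset.range e) fun i _ =>
    (HasValue.one.sub (hX (4 * i + 3))).mul (HasValue.one.sub (hX (4 * i + 5))))
  have h5 : ∏ i ∈ Finset.range e, ((1 - ζ ^ (4 * i + 3)) * (1 - ζ ^ (4 * i + 5))) = 0 := by
    -- The odd number `2e+1` has the form `4i+5` or `4i+3` with `i < e`, by the parity of `e`; `0 <
    -- e` is needed for `c - 1`.
    rcases Nat.even_or_odd' e with ⟨c, hc | hc⟩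
    · refine Finset.prod_eq_zero (i := c - 1) (Finset.mem_range.2 (by omega)) ?_
      rw [show 4 * (c - 1) + 5 = 2 * e + 1 by omega, h.pow_eq_one, sub_self, mul_zero]
    · refine Finset.prod_eq_zero (i := c) (Finset.mem_range.2 (by omega)) ?_
      rw [show 4 * c + 3 = 2 * e + 1 by omega, h.pow_eq_one, sub_self, zero_mul]
  rw [h5] at h4
  rw [h1]
  refine (mul_eq_zero.1 h4).resolve_right (Finset.prod_ne_zero_iff.2 fun i _ => ?_)
  exact pow_ne_zero 2 (h.one_add_pow_ne_zero _)

/-- Over one block, numerator and denominator each have exactly one factor vanishing at `ζ`: `1 -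
y^(2u+1)` and `1 - y^(2u+2)` with `y = q^(2d)`, `d = 2e+1`. Dividing both by `1 - y` leaves a
quotient with value `(2u+1)/(2u+2)`. -/
theorem hasValue_qShifted_block (h : IsPrimitiveRoot ζ (2 * e + 1)) (u : ℕ) :
    ∃ z, HasValue ζ
      (qShifted (RatFunc.X ^ 2 * (RatFunc.X ^ 4) ^ (u * (2 * e + 1))) (RatFunc.X ^ 4) (2 * e + 1) /
        qShifted (RatFunc.X ^ 4 * (RatFunc.X ^ 4) ^ (u * (2 * e + 1))) (RatFunc.X ^ 4)
          (2 * e + 1)) z := by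
  have hX (j : ℕ) : HasValue ζ (RatFunc.X ^ j) (ζ ^ j) := HasValue.X.pow j
  set q : RatFunc ℤ := RatFunc.X
  set y : RatFunc ℤ := q ^ (2 * (2 * e + 1)) with hy
  have hy1 : y ≠ 1 := RatFunc.X_pow_ne_one (by omega)
  have hyv : HasValue ζ y 1 := by
    have := hX (2 * (2 * e + 1))
    rwa [mul_comm 2, pow_mul ζ, h.pow_eq_one, one_pow, mul_comm] at this
  have hone (k : ℕ) : qInt (1 : ℂ) k = k := by simp [qInt]
  have hnum : qShifted (q ^ 2 * (q ^ 4) ^ (u * (2 * e + 1))) (q ^ 4) (2 * e + 1) =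
      qShifted (q ^ 2 * (q ^ 4) ^ (u * (2 * e + 1))) (q ^ 4) e *
        qShifted (q ^ 2 * (q ^ 4) ^ (u * (2 * e + 1)) * (q ^ 4) ^ (e + 1)) (q ^ 4) e *
        (1 - y ^ (2 * u + 1)) := by
    rw [show 2 * e + 1 = e + 1 + e by ring, qShifted_add, qShifted_add _ _ e 1, hy]
    simp only [qShifted, Finset.prod_range_one]
    ring
  have hden : qShifted (q ^ 4 * (q ^ 4) ^ (u * (2 * e + 1))) (q ^ 4) (2 * e + 1) =
      qShifted (q ^ 4 * (q ^ 4) ^ (u * (2 * e + 1))) (q ^ 4) (2 * e) * (1 - y ^ (2 * u + 2)) := by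
    rw [qShifted_add _ _ (2 * e) 1, hy]
    simp only [qShifted, Finset.prod_range_one]
    ring
  have hratio : (1 - y ^ (2 * u + 1)) / (1 - y ^ (2 * u + 2)) =
      qInt y (2 * u + 1) / qInt y (2 * u + 2) := by
    rw [qInt_eq_div hy1, qInt_eq_div hy1, div_div_div_cancel_right₀ (sub_ne_zero.2 hy1.symm)]
  rw [hnum, hden, mul_div_mul_comm, hratio]
  refine ⟨_, HasValue.mul (HasValue.div (HasValue.mul
    (HasValue.qShifted ((hX 2).mul ((hX 4).pow (u * (2 * e + 1)))) (hX 4) e)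
    (HasValue.qShifted (((hX 2).mul ((hX 4).pow (u * (2 * e + 1)))).mul ((hX 4).pow (e + 1)))
      (hX 4) e))
    (HasValue.qShifted ((hX 4).mul ((hX 4).pow (u * (2 * e + 1)))) (hX 4) (2 * e)) ?_)
    (HasValue.div (hyv.qInt (2 * u + 1)) (hyv.qInt (2 * u + 2)) ?_)⟩
  · rw [mul_comm u, ← pow_mul, mul_left_comm, pow_mul ζ, h.pow_eq_one, one_pow, mul_one]
    exact qShifted_four_ne_zero h le_rfl
  · rw [hone, Nat.cast_ne_zero]
    omega

theorem hasValue_qShifted_ratio (h : IsPrimitiveRoot ζ (2 * e + 1)) (u : ℕ) :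
    ∃ z, HasValue ζ (qShifted (RatFunc.X ^ 2) (RatFunc.X ^ 4) (u * (2 * e + 1)) /
        qShifted (RatFunc.X ^ 4) (RatFunc.X ^ 4) (u * (2 * e + 1))) z := by
  induction u with
  | zero => exact ⟨1, by simpa [qShifted] using HasValue.one⟩
  | succ u ih =>
    obtain ⟨z, hz⟩ := ih
    obtain ⟨w, hw⟩ := hasValue_qShifted_block h u
    refine ⟨z * w, ?_⟩
    rw [add_one_mul, qShifted_add _ _ (u * (2 * e + 1)), qShifted_add _ _ (u * (2 * e + 1)),
      mul_div_mul_comm]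
    exact hz.mul hw

/-- All parts of the term other than the ratio of `hasValue_qShifted_ratio` are regular at `ζ`, and
`ζ^d = 1` removes the shift by whole blocks. Only the independence of `C u` from `v` matters later,
not its value. -/
theorem hasValue_cTerm (h : IsPrimitiveRoot ζ (2 * e + 1)) (he : 0 < e) :
    ∃ C : ℕ → ℂ, ∀ u v, v < 2 * e + 1 →
      HasValue ζ (cTerm RatFunc.X (u * (2 * e + 1) + v)) (C u * cTerm ζ v) := by
  choose H hH using hasValue_qShifted_ratio h
  refine ⟨fun u => H u * (qShifted (-ζ) (ζ ^ 2) (u * (2 * e + 1)) ^ 2 /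
    qShifted (-ζ ^ 4) (ζ ^ 4) (u * (2 * e + 1)) ^ 2), fun u v hv => ?_⟩
  have hX (j : ℕ) : HasValue ζ (RatFunc.X ^ j) (ζ ^ j) := HasValue.X.pow j
  set k := u * (2 * e + 1) with hk
  have hζ (j : ℕ) : (ζ ^ j) ^ k = 1 := by
    rw [hk, ← pow_mul, mul_comm u, mul_left_comm, pow_mul, h.pow_eq_one, one_pow]
  have hζ1 : ζ ≠ 1 := h.ne_one (by omega)
  have h1 : HasValue ζ (qShifted (RatFunc.X ^ 2) (RatFunc.X ^ 4) (k + v) /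
      qShifted (RatFunc.X ^ 4) (RatFunc.X ^ 4) (k + v))
      (H u * (qShifted (ζ ^ 2) (ζ ^ 4) v / qShifted (ζ ^ 4) (ζ ^ 4) v)) := by
    rw [qShifted_add, qShifted_add _ _ k, mul_div_mul_comm]
    have := HasValue.div (HasValue.qShifted ((hX 2).mul ((hX 4).pow k)) (hX 4) v)
      (HasValue.qShifted ((hX 4).mul ((hX 4).pow k)) (hX 4) v)
    simp only [hζ, mul_one] at this
    exact (hH u).mul (this (qShifted_four_ne_zero h (by omega)))
  have h2 : HasValue ζ (qShifted (-RatFunc.X) (RatFunc.X ^ 2) (k + v))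
      (qShifted (-ζ) (ζ ^ 2) k * qShifted (-ζ) (ζ ^ 2) v) := by
    have := HasValue.qShifted HasValue.X.neg (hX 2) (k + v)
    rwa [qShifted_add (-ζ), hζ, mul_one] at this
  have h3 : HasValue ζ (qShifted (-RatFunc.X ^ 4) (RatFunc.X ^ 4) (k + v))
      (qShifted (-ζ ^ 4) (ζ ^ 4) k * qShifted (-ζ ^ 4) (ζ ^ 4) v) := by
    have := HasValue.qShifted (hX 4).neg (hX 4) (k + v)
    rwa [qShifted_add (-ζ ^ 4), hζ, mul_one] at this
  have h4 : HasValue ζ (qInt RatFunc.X (6 * (k + v) + 1)) (qInt ζ (6 * v + 1)) := by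
    have hq : qInt ζ (6 * (k + v) + 1) = qInt ζ (6 * v + 1) := by
      rw [qInt_eq_div hζ1, qInt_eq_div hζ1, show 6 * (k + v) + 1 = 6 * k + (6 * v + 1) by ring,
        pow_add, pow_mul, hζ, one_mul]
    exact hq ▸ HasValue.X.qInt _
  have h5 : HasValue ζ (RatFunc.X ^ (k + v) ^ 2) (ζ ^ v ^ 2) := by
    have hp : ζ ^ (k + v) ^ 2 = ζ ^ v ^ 2 := by
      rw [show (k + v) ^ 2 = (k + 2 * v) * k + v ^ 2 by ring, pow_add, pow_mul, hζ, one_mul]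
    exact hp ▸ hX _
  have h6 := ((h1.mul ((h2.pow 2).div (h3.pow 2) (pow_ne_zero 2 (mul_ne_zero
    (qShifted_neg_four_ne_zero h k) (qShifted_neg_four_ne_zero h v))))).mul h4).mul h5
  rw [← mul_div_mul_comm] at h6
  refine Eq.subst ?_ h6
  simp only [cTerm, ← hk]
  ring

end RootOfUnity

/-! ### Summation by blocks and the Cauchy square -/

/-- Complete blocks contribute 0, so only the last, possibly partial, one survives. Allowing `r = d`
lets the induction hypothesis cover a complete block. -/
theorem sum_range_blocks {R : Type*} [CommRing R] {d : ℕ} {w C g : ℕ → R}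
    (hw : ∀ u v, v < d → w (u * d + v) = C u * g v) (hg : ∑ v ∈ Finset.range d, g v = 0)
    (u : ℕ) {r : ℕ} (hr : r ≤ d) :
    ∑ k ∈ Finset.range (u * d + r), w k = C u * ∑ v ∈ Finset.range r, g v := by
  induction u generalizing r with
  | zero =>
    rw [zero_mul, zero_add, Finset.mul_sum]
    refine Finset.sum_congr rfl fun k hk => ?_
    simpa using hw 0 k ((Finset.mem_range.1 hk).trans_le hr)
  | succ u ih =>
    rw [Finset.sum_range_add, add_one_mul, ih le_rfl, hg, mul_zero, zero_add, Finset.mul_sum]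
    refine Finset.sum_congr rfl fun k hk => ?_
    rw [← add_one_mul, hw _ _ ((Finset.mem_range.1 hk).trans_le hr)]

theorem hasValue_sum_aTerm {ζ : ℂ} {e : ℕ} (h : IsPrimitiveRoot ζ (2 * e + 1)) (he : 0 < e)
    (m : ℕ) :
    HasValue ζ (∑ k ∈ Finset.range (m * (2 * e + 1)), aTerm RatFunc.X k) 0 := by
  obtain ⟨C, hC⟩ := hasValue_cTerm h he
  set d := 2 * e + 1 with hd
  have hd0 : 0 < d := by omega
  let w : ℕ → ℂ := fun k => C (k / d) * cTerm ζ (k % d)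
  have hw (u v : ℕ) (hv : v < d) : w (u * d + v) = C u * cTerm ζ v := by
    simp only [w]
    rw [mul_comm u, Nat.mul_add_div hd0, Nat.mul_add_mod, Nat.div_eq_of_lt hv,
      Nat.mod_eq_of_lt hv, add_zero]
  have hc (k : ℕ) : HasValue ζ (cTerm RatFunc.X k) (w k) := by
    have := hC (k / d) (k % d) (Nat.mod_lt _ hd0)
    rwa [Nat.div_add_mod'] at this
  simp only [aTerm]
  rw [Finset.sum_range_diag_flip _ fun i j => cTerm RatFunc.X i * cTerm RatFunc.X j]
  have h1 : HasValue ζ (∑ i ∈ Finset.range (m * d), ∑ j ∈ Finset.range (m * d - i),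
      cTerm RatFunc.X i * cTerm RatFunc.X j)
      (∑ i ∈ Finset.range (m * d), ∑ j ∈ Finset.range (m * d - i), w i * w j) :=
    HasValue.sum fun i _ => HasValue.sum fun j _ => (hc i).mul (hc j)
  convert h1
  refine (Finset.sum_eq_zero fun i hi => ?_).symm
  rw [← Finset.mul_sum]
  have hv := Nat.mod_lt i hd0
  have hu : i / d < m := Nat.div_lt_of_lt_mul (by rw [mul_comm]; exact Finset.mem_range.1 hi)
  -- If `i % d ≤ e`, the inner sum has `t` full blocks and `d - i % d > e` further terms, enough to
  -- cover the nonzero part of a block.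
  rcases lt_or_ge e (i % d) with hlt | hle
  · simp only [w, cTerm_eq_zero h hlt, mul_zero, zero_mul]
  · obtain ⟨t, ht⟩ := Nat.exists_eq_add_of_lt hu
    have hn : m * d - i = t * d + (d - i % d) := by
      have h2 := Nat.div_add_mod' i d
      have h3 : m * d = i / d * d + t * d + d := by rw [ht]; ring
      omega
    rw [hn, sum_range_blocks hw (sum_cTerm_eq_zero h he (by omega)) t (Nat.sub_le _ _),
      sum_cTerm_eq_zero h he (by omega), mul_zero, mul_zero]

/-! ### From zeros at roots of unity to divisibility by `[n]` -/

theorem isRelPrime_cyclotomic {i j : ℕ} (hi : 0 < i) (hj : 0 < j) (hij : i ≠ j) :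
    IsRelPrime (cyclotomic i ℤ) (cyclotomic j ℤ) := by
  rw [(cyclotomic.irreducible hi).isRelPrime_iff_not_dvd]
  intro h
  exact hij (cyclotomic_injective (eq_of_monic_of_associated (cyclotomic.monic i ℤ)
    (cyclotomic.monic j ℤ) ((cyclotomic.irreducible hi).associated_of_dvd
      (cyclotomic.irreducible hj) h)))

/-- Write `f = A/B` in lowest terms. One zero per `d` suffices because `Φ_d` is the minimal
polynomial of `ζ`: it divides `A`, hence not `B`. The `Φ_d` are pairwise relatively prime, so their
product `[n]` inherits both properties. -/
theorem ratCongr_zero_of_hasValue {f : RatFunc ℤ} {n : ℕ} (hn : 0 < n)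
    (h : ∀ d, d ∣ n → d ≠ 1 → ∃ ζ : ℂ, IsPrimitiveRoot ζ d ∧ HasValue ζ f 0) :
    RatCongr f 0 (qInt (X : ℤ[X]) n) := by
  obtain ⟨A, B, hAB, hf⟩ := IsFractionRing.exists_reduced_fraction (A := ℤ[X]) f
  have hB : (B : ℤ[X]) ≠ 0 := nonZeroDivisors.coe_ne_zero B
  have hf' : f * algebraMap ℤ[X] (RatFunc ℤ) B = algebraMap ℤ[X] (RatFunc ℤ) A := by
    rw [← hf, IsFractionRing.mk'_eq_div, div_mul_cancel₀]
    simp [hB]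
  have key (d : ℕ) (hd : d ∈ n.divisors.erase 1) :
      cyclotomic d ℤ ∣ A ∧ IsRelPrime (cyclotomic d ℤ) (B : ℤ[X]) := by
    obtain ⟨hd1, hdn⟩ := Finset.mem_erase.1 hd
    have hdn' := Nat.dvd_of_mem_divisors hdn
    have hd0 := Nat.pos_of_dvd_of_pos hdn' hn
    obtain ⟨ζ, hζ, a, b, hb, h1, h2⟩ := h d hdn' hd1
    have hdvd (p : ℤ[X]) : cyclotomic d ℤ ∣ p ↔ aeval ζ p = 0 := by
      rw [cyclotomic_eq_minpoly hζ hd0]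
      exact (minpoly.isIntegrallyClosed_dvd_iff (hζ.isIntegral hd0) p).symm
    have hirr := cyclotomic.irreducible hd0
    have hprod : A * b = a * B := by
      apply RatFunc.algebraMap_injective ℤ
      rw [map_mul, map_mul, ← hf', ← h1]
      ring
    have hA : cyclotomic d ℤ ∣ A := by
      have h3 : cyclotomic d ℤ ∣ A * b := by
        rw [hprod]
        exact Dvd.dvd.mul_right ((hdvd a).2 (by rw [← h2, zero_mul])) _
      exact (hirr.prime.dvd_or_dvd h3).resolve_right fun hb' => hb ((hdvd b).1 hb')
    exact ⟨hA, hirr.isRelPrime_iff_not_dvd.2 fun hB' => hirr.not_isUnit (hAB hA hB')⟩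
  rw [qInt, ← prod_cyclotomic_eq_geom_sum hn]
  refine ⟨A, B, hB, ?_, ?_, ?_⟩
  · rw [sub_zero, ← hf, IsFractionRing.mk'_eq_div]
  · refine Finset.prod_dvd_of_isRelPrime ?_ fun d hd => (key d hd).1
    intro i hi j hj hij
    exact isRelPrime_cyclotomic (Nat.pos_of_mem_divisors (Finset.mem_of_mem_erase hi))
      (Nat.pos_of_mem_divisors (Finset.mem_of_mem_erase hj)) hij
  · exact IsRelPrime.prod_left fun d hd => (key d hd).2

theorem theorem2 (n : ℕ) (hn : Odd n) :
    RatCongr (∑ k ∈ Finset.range n, aTerm (RatFunc.X : RatFunc ℤ) k) 0 (qInt (X : ℤ[X]) n) := by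
  refine ratCongr_zero_of_hasValue hn.pos fun d hd hd1 => ?_
  obtain ⟨e, rfl⟩ := hn.of_dvd_nat hd
  obtain ⟨m, rfl⟩ := hd
  have hζ := Complex.isPrimitiveRoot_exp (2 * e + 1) (Nat.succ_ne_zero _)
  refine ⟨_, hζ, ?_⟩
  rw [mul_comm _ m]
  exact hasValue_sum_aTerm hζ (by omega) m
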